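/- Let $\Sigma$ be a finite nonempty alphabet and $S$ a finite set. Write $\mathbb N^{\Sigma^*}$ for the set of functions $\Sigma^*\to\mathbb N$ (multisets of words) with the product $\sigma$-algebra, and let $\mathcal S(\mathbb N^{\Sigma^*})$ be the $\mathbb R$-algebra of finite signed measures on it, with multiplication $\mu\mathbin{\&}\nu$ the pushforward of $\mu\otimes\nu$ under pointwise addition and unit the point mass at $0$. A word $x$ acts on multisets by $(x\cdot\alpha)(xz)=\alpha(z)$ and $(x\cdot\alpha)(y)=0$ if $x$ is not a prefix of $y$, and on measures by pushforward; put $\epsilon=\delta_{\{\varepsilon\}}$, where $\varepsilon$ is the empty word. Let $F=\mathbb R[\Sigma^*\cdot\epsilon,\Sigma^*\cdot S]$ be the polynomial algebra in the indeterminates $x\cdot\epsilon$ and $x\cdot s$ ($x\in\Sigma^*$, $s\in S$), on which words act by $x\cdot(y\cdot\epsilon)=xy\cdot\epsilon$, $x\cdot(y\cdot s)=xy\cdot s$; identify $s$ with $\varepsilon\cdot s$ and $\epsilon$ with $\varepsilon\cdot\epsilon$. For an $\mathbb R$-algebra $V$ with an action of $\Sigma^*$ by algebra endomorphisms and a distinguished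 element $\epsilon$, a map $f:S\to V$ extends to the algebra homomorphism $f^\ddagger:F\to V$ with $f^\ddagger(x\cdot\epsilon)=x\cdot\epsilon$ and $f^\ddagger(x\cdot s)=x\cdot f(s)$. Let $\mathbb 1:F\to\mathbb R$ map every indeterminate to $1$. An automaton with state set $S$ is a map $\theta:S\to\mathbb R[\epsilon,\Sigma\cdot S]\subseteq F$ such that each $\theta(s)$ has nonnegative coefficients with sum $1$. Its semantics is the map $\llbracket-\rrbracket$ from $S$ to the probability measures on $\mathbb N^{\Sigma^*}$ with $\llbracket s\rrbracket=\llbracket-\rrbracket^\ddagger(\theta(s))$ for all $s\in S$. Let $\mathcal S(\mathbb N^S)$ be the $\mathbb R$-algebra (with the operations defined as above) of signed measures with finite support on $\mathbb N^S$, and $\phi_S:\mathbb R[S]\to\mathcal S(\mathbb N^S)$ the algebra isomorphism with $\phi_S(s)=\delta_{\{s\}}$; for $\mu\in\mathcal S(\mathbb N^S)$ put $\llbracket\mu\rrbracket=\llbracket-\rrbracket^\ddagger(\phi_S^{-1}(\mu))$. A finite tree is a finite prefix-closed set $A\subseteq\Sigma^*$, and $\partial A$ is the set of prefix-minimal elements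 of $\Sigma^*\setminus A$. For $x\in\Sigma^*$ let $x\cdot\theta:F\to F$ be the algebra homomorphism that maps $xz\cdot s$ to $xz\cdot\theta(s)$ for $z\in\Sigma^*$, $s\in S$, and fixes all other indeterminates. Algebra homomorphisms $\theta_A:\mathbb R[S]\to\mathbb R[A\cdot\epsilon,\partial A\cdot S]$ are defined by $\theta_\emptyset=\mathrm{id}$ and $\theta_{A\cup\{x\}}=(x\cdot\theta)\circ\theta_A$ for $x\in\partial A$. For a monomial $m$ in the indeterminates $y\cdot\epsilon$, $y\in A$, let $d_A^m(p)\in\mathbb R[\partial A\cdot S]$ be the coefficient of $m$ in $\theta_A(p)$, so $\theta_A(p)=\sum_m d_A^m(p)\,m$; for $x\in\partial A$ let $d_{A,x}^m(p)\in\mathbb R[S]$ be the polynomial for which $x\cdot d_{A,x}^m(p)$ is obtained from $d_A^m(p)$ by substituting $1$ for all $y\cdot s$ with $y\in\partial A\setminus\{x\}$, $s\in S$. Theorem. For every automaton $\theta:S\to\mathbb R[\epsilon,\Sigma\cdot S]$ the semantics $\llbracket-\rrbracket$ exists and is unique. For all $\mu,\nu\in\mathcal S(\mathbb N^S)$, with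 $p=\phi_S^{-1}(\mu-\nu)\in\mathbb R[S]$, one has $\llbracket\mu\rrbracket=\llbracket\nu\rrbracket$ if and only if, for all finite trees $A\subseteq\Sigma^*$, all $x\in\partial A$ and all monomials $m$ in the indeterminates $y\cdot\epsilon$, $y\in A$, $$d_{A,x}^m(p)\in\ker\mathbb 1 .$$ -/

import Mathlib

open MeasureTheory

namespace PKA

noncomputable section

section SignedMeasures


variable {X Y : Type*} [MeasurableSpace X] [MeasurableSpace Y]

instance instFiniteVariation (μ : SignedMeasure X) : IsFiniteMeasure μ.variation := by
  rw [← SignedMeasure.totalVariation_eq_variation]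
  infer_instance

/-- The independent product `μ ⊗ ν` of two finite signed measures. -/
def tensor (μ : SignedMeasure X) (ν : SignedMeasure Y) : SignedMeasure (X × Y) :=
  VectorMeasure.prod μ ν (ContinuousLinearMap.mul ℝ ℝ)

theorem tensor_apply (μ : SignedMeasure X) (ν : SignedMeasure Y) (s : Set X) (t : Set Y) :
    tensor μ ν (s ×ˢ t) = μ s * ν t := by
  simp [tensor]

theorem tensor_eq {μ : SignedMeasure X} {ν : SignedMeasure Y} {ρ : SignedMeasure (X × Y)}
    (h : ∀ s t, MeasurableSet s → MeasurableSet t → ρ (s ×ˢ t) = μ s * ν t) :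
    tensor μ ν = ρ :=
  VectorMeasure.prod_eq_of_forall_apply_prod (by simpa using h)

theorem map_map {Z : Type*} [MeasurableSpace Z] (μ : SignedMeasure X) {f : X → Y} {g : Y → Z}
    (hf : Measurable f) (hg : Measurable g) : (μ.map f).map g = μ.map (g ∘ f) := by
  ext s hs
  rw [VectorMeasure.map_apply _ hg hs, VectorMeasure.map_apply _ hf (hg hs),
    VectorMeasure.map_apply _ (hg.comp hf) hs, Set.preimage_comp]

theorem map_dirac {f : X → Y} (hf : Measurable f) (x : X) (r : ℝ) :
    (VectorMeasure.dirac x r).map f = VectorMeasure.dirac (f x) r := by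
  ext s hs
  rw [VectorMeasure.map_apply _ hf hs]
  by_cases h : f x ∈ s
  · rw [VectorMeasure.dirac_apply_of_mem (hf hs) h, VectorMeasure.dirac_apply_of_mem hs h]
  · rw [VectorMeasure.dirac_apply_of_notMem (by exact h), VectorMeasure.dirac_apply_of_notMem h]

theorem tensor_map {X' Y' : Type*} [MeasurableSpace X'] [MeasurableSpace Y']
    (μ : SignedMeasure X) (ν : SignedMeasure Y) {f : X → X'} {g : Y → Y'}
    (hf : Measurable f) (hg : Measurable g) :
    tensor (μ.map f) (ν.map g) = (tensor μ ν).map (Prod.map f g) := by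
  refine tensor_eq fun s t hs ht => ?_
  rw [VectorMeasure.map_apply _ (hf.prodMap hg) (hs.prod ht), VectorMeasure.map_apply _ hf hs,
    VectorMeasure.map_apply _ hg ht, Set.preimage_prod_map_prod, tensor_apply]

theorem tensor_dirac (x : X) (y : Y) (r s : ℝ) :
    tensor (VectorMeasure.dirac x r) (VectorMeasure.dirac y s) =
      VectorMeasure.dirac (x, y) (r * s) := by
  refine tensor_eq fun a b ha hb => ?_
  by_cases h₁ : x ∈ a
  · by_cases h₂ : y ∈ b
    · rw [VectorMeasure.dirac_apply_of_mem (ha.prod hb) ⟨h₁, h₂⟩,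
        VectorMeasure.dirac_apply_of_mem ha h₁, VectorMeasure.dirac_apply_of_mem hb h₂]
    · rw [VectorMeasure.dirac_apply_of_notMem (fun h => h₂ h.2),
        VectorMeasure.dirac_apply_of_notMem h₂, mul_zero]
  · rw [VectorMeasure.dirac_apply_of_notMem (fun h => h₁ h.1),
      VectorMeasure.dirac_apply_of_notMem h₁, zero_mul]

theorem tensor_add (μ : SignedMeasure X) (ν ρ : SignedMeasure Y) :
    tensor μ (ν + ρ) = tensor μ ν + tensor μ ρ :=
  tensor_eq fun s t _ _ => by simp [tensor_apply, mul_add]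

theorem tensor_smul (r : ℝ) (μ : SignedMeasure X) (ν : SignedMeasure Y) :
    tensor μ (r • ν) = r • tensor μ ν :=
  tensor_eq fun s t _ _ => by simp [tensor_apply]; ring

theorem tensor_swap (μ : SignedMeasure X) (ν : SignedMeasure Y) :
    tensor ν μ = (tensor μ ν).map Prod.swap :=
  tensor_eq fun s t hs ht => by
    rw [VectorMeasure.map_apply _ measurable_swap (hs.prod ht), Set.preimage_swap_prod,
      tensor_apply, mul_comm]

theorem tensor_assoc {Z : Type*} [MeasurableSpace Z] (μ : SignedMeasure X) (ν : SignedMeasure Y)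
    (ρ : SignedMeasure Z) :
    tensor μ (tensor ν ρ) = (tensor (tensor μ ν) ρ).map MeasurableEquiv.prodAssoc := by
  have hm := (MeasurableEquiv.prodAssoc (α := X) (β := Y) (γ := Z)).measurable
  refine VectorMeasure.ext_of_generateFrom
    (Set.image2 (fun s u => s ×ˢ u) {s : Set X | MeasurableSet s}
      (Set.image2 (fun t u => t ×ˢ u) {t : Set Y | MeasurableSet t} {u : Set Z | MeasurableSet u}))
    ?_ ?_ ?_ ?_
  · rintro _ ⟨s, hs, _, ⟨t, ht, u, hu, rfl⟩, rfl⟩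
    simp only [Set.mem_ofPred_eq] at hs ht hu
    rw [VectorMeasure.map_apply _ hm (hs.prod (ht.prod hu))]
    have : MeasurableEquiv.prodAssoc ⁻¹' (s ×ˢ t ×ˢ u) = (s ×ˢ t) ×ˢ u := by
      ext ⟨⟨a, b⟩, c⟩; simp [MeasurableEquiv.prodAssoc, and_assoc]
    rw [this]
    simp only [tensor_apply]
    ring
  · refine (generateFrom_eq_prod MeasurableSpace.generateFrom_measurableSet generateFrom_prod
      ?_ ?_).symm
    · exact ⟨fun _ => Set.univ, fun _ => MeasurableSet.univ, Set.iUnion_const _⟩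
    · exact ⟨fun _ => Set.univ, fun _ => ⟨Set.univ, MeasurableSet.univ, Set.univ,
        MeasurableSet.univ, Set.univ_prod_univ⟩, Set.iUnion_const _⟩
  · exact MeasurableSpace.isPiSystem_measurableSet.prod isPiSystem_prod
  · rw [VectorMeasure.map_apply _ hm MeasurableSet.univ, Set.preimage_univ]
    simp only [← Set.univ_prod_univ, tensor_apply]
    ring

variable [AddCommMonoid X] [MeasurableAdd₂ X] [AddCommMonoid Y] [MeasurableAdd₂ Y]

theorem measurable_sum_pair : Measurable fun z : X × X => z.1 + z.2 :=
  measurable_fst.add measurable_snd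

/-- Nondeterministic choice `μ & ν`: the pushforward of `μ ⊗ ν` under addition. When `X` is a
space of multisets (functions to `ℕ`), addition is multiset union. -/
def choice (μ ν : SignedMeasure X) : SignedMeasure X :=
  (tensor μ ν).map fun z => z.1 + z.2

theorem choice_comm (μ ν : SignedMeasure X) : choice μ ν = choice ν μ := by
  unfold choice
  rw [tensor_swap μ ν, map_map _ measurable_swap measurable_sum_pair]
  congr 1
  ext z
  exact add_comm _ _

theorem choice_add (μ ν ρ : SignedMeasure X) :
    choice μ (ν + ρ) = choice μ ν + choice μ ρ := by
  simp only [choice, tensor_add, VectorMeasure.map_add]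

theorem choice_smul (r : ℝ) (μ ν : SignedMeasure X) : choice μ (r • ν) = r • choice μ ν := by
  simp only [choice, tensor_smul, VectorMeasure.map_smul]

theorem choice_zero (μ : SignedMeasure X) : choice μ 0 = 0 := by
  simpa using choice_smul 0 μ 0

theorem choice_dirac (x y : X) (r s : ℝ) :
    choice (VectorMeasure.dirac x r) (VectorMeasure.dirac y s) =
      VectorMeasure.dirac (x + y) (r * s) := by
  rw [choice, tensor_dirac, map_dirac measurable_sum_pair]

theorem one_choice (μ : SignedMeasure X) : choice (VectorMeasure.dirac 0 1) μ = μ := by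
  have h : tensor (VectorMeasure.dirac (0 : X) (1 : ℝ)) μ = μ.map fun x => ((0 : X), x) := by
    refine tensor_eq fun s t hs ht => ?_
    rw [VectorMeasure.map_apply _ measurable_prodMk_left (hs.prod ht)]
    by_cases h : (0 : X) ∈ s
    · rw [VectorMeasure.dirac_apply_of_mem hs h, one_mul]
      congr 1
      ext; simp [h]
    · rw [VectorMeasure.dirac_apply_of_notMem h, zero_mul]
      have : (fun x : X => ((0 : X), x)) ⁻¹' s ×ˢ t = ∅ := by ext; simp [h]
      rw [this, VectorMeasure.empty]
  rw [choice, h, map_map _ measurable_prodMk_left measurable_sum_pair]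
  have : ((fun z : X × X => z.1 + z.2) ∘ fun x => ((0 : X), x)) = id := by ext; simp
  rw [this, VectorMeasure.map_id]

theorem choice_assoc (μ ν ρ : SignedMeasure X) :
    choice (choice μ ν) ρ = choice μ (choice ν ρ) := by
  have h₁ := tensor_map (tensor μ ν) ρ (measurable_sum_pair (X := X)) measurable_id
  have h₂ := tensor_map μ (tensor ν ρ) measurable_id (measurable_sum_pair (X := X))
  rw [VectorMeasure.map_id] at h₁ h₂
  unfold choice
  rw [h₁, h₂, tensor_assoc, map_map _ (measurable_sum_pair.prodMap measurable_id)
      measurable_sum_pair, map_map _ MeasurableEquiv.prodAssoc.measurable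
      (measurable_id.prodMap measurable_sum_pair), map_map _
      ((measurable_id.prodMap measurable_sum_pair).comp MeasurableEquiv.prodAssoc.measurable)
      measurable_sum_pair]
  congr 1
  ext ⟨⟨a, b⟩, c⟩
  exact add_assoc a b c

/-- The algebra of finite signed measures: pointwise vector space operations, multiplication
`&`, unit the point mass at the empty multiset `0`. -/
instance instCommRingSignedMeasure : CommRing (SignedMeasure X) where
  __ := (inferInstance : AddCommGroup (SignedMeasure X))
  mul := choice
  one := VectorMeasure.dirac 0 1
  mul_assoc := choice_assoc
  one_mul := one_choice
  mul_one μ := (choice_comm _ _).trans (one_choice μ)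
  left_distrib := choice_add
  right_distrib μ ν ρ := by
    change choice (μ + ν) ρ = choice μ ρ + choice ν ρ
    rw [choice_comm, choice_add, choice_comm ρ, choice_comm ρ]
  zero_mul μ := by
    change choice 0 μ = 0
    rw [choice_comm, choice_zero]
  mul_zero := choice_zero
  mul_comm := choice_comm

instance instAlgebraSignedMeasure : Algebra ℝ (SignedMeasure X) :=
  Algebra.ofModule
    (fun r μ ν => by
      change choice (r • μ) ν = r • choice μ ν
      rw [choice_comm, choice_smul, choice_comm])
    (fun r μ ν => choice_smul r μ ν)

theorem dirac_mul (x y : X) (r s : ℝ) :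
    (VectorMeasure.dirac x r * VectorMeasure.dirac y s : SignedMeasure X) =
      VectorMeasure.dirac (x + y) (r * s) :=
  choice_dirac x y r s

/-- Pushforward of signed measures along a measurable additive map. -/
def pushforward (f : X →+ Y) (hf : Measurable f) : SignedMeasure X →ₐ[ℝ] SignedMeasure Y :=
  AlgHom.ofLinearMap (VectorMeasure.mapₗ f)
    (by
      change (VectorMeasure.dirac (0 : X) (1 : ℝ)).map f = VectorMeasure.dirac 0 1
      rw [map_dirac hf, map_zero])
    (fun μ ν => by
      change (choice μ ν).map f = choice (μ.map f) (ν.map f)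
      unfold choice
      rw [tensor_map _ _ hf hf, map_map _ measurable_sum_pair hf,
        map_map _ (hf.prodMap hf) measurable_sum_pair]
      congr 1
      ext z
      exact map_add f _ _)

theorem pushforward_apply (f : X →+ Y) (hf : Measurable f) (μ : SignedMeasure X) :
    pushforward f hf μ = μ.map f := rfl

end SignedMeasures

section FiniteSupport

variable (S : Type*) [Finite S]

open scoped Classical in
theorem eq_sum_dirac {S : Type*} [Finite S] (μ : SignedMeasure (S → ℕ))
    (h : {m | μ {m} ≠ 0}.Finite) :
    μ = ∑ m ∈ h.toFinset, VectorMeasure.dirac m (μ {m}) := by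
  have key : ∀ B : Set (S → ℕ), HasSum (fun m => if m ∈ B then μ {m} else 0) (μ B) := by
    intro B
    have hB : (⋃ m : S → ℕ, {m} ∩ B) = B := by ext; simp
    have := VectorMeasure.hasSum_of_disjoint_iUnion (v := μ) (f := fun m : S → ℕ => {m} ∩ B)
      (fun m => (Set.to_countable _).measurableSet)
      (fun a b hab => by
        simp only [Function.onFun]
        exact (Set.disjoint_singleton.2 hab).mono Set.inter_subset_left Set.inter_subset_left)
    rw [hB] at this
    convert this using 2 with m
    split_ifs with hm
    · congr 1; ext; simp; rintro rfl; exact hm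
    · have : ({m} ∩ B : Set (S → ℕ)) = ∅ := by ext; simp; rintro rfl; exact hm
      rw [this, VectorMeasure.empty]
  ext B hB
  refine (key B).unique ?_
  have h2 : (∑ m ∈ h.toFinset, VectorMeasure.dirac m (μ {m})) B =
      ∑ m ∈ h.toFinset, if m ∈ B then μ {m} else 0 := by
    have hs : ∀ F : Finset (S → ℕ), (∑ m ∈ F, VectorMeasure.dirac m (μ {m})) B =
        ∑ m ∈ F, (VectorMeasure.dirac m (μ {m}) : SignedMeasure (S → ℕ)) B := by
      intro F
      induction F using Finset.induction_on with
      | empty => simp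
      | insert a F ha ih => rw [Finset.sum_insert ha, Finset.sum_insert ha, ← ih]; rfl
    rw [hs]
    refine Finset.sum_congr rfl fun m _ => ?_
    split_ifs with hm
    · exact VectorMeasure.dirac_apply_of_mem hB hm
    · exact VectorMeasure.dirac_apply_of_notMem hm
  rw [h2]
  refine hasSum_sum_of_ne_finset_zero fun m hm => ?_
  simp only [Set.Finite.mem_toFinset, Set.mem_ofPred_eq, not_not] at hm
  simp [hm]

theorem dirac_eq_smul {X : Type*} [MeasurableSpace X] (x : X) (r : ℝ) :
    (VectorMeasure.dirac x r : SignedMeasure X) = r • VectorMeasure.dirac x 1 := by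
  ext B hB
  by_cases h : x ∈ B
  · simp [VectorMeasure.dirac_apply_of_mem hB h]
  · simp [VectorMeasure.dirac_apply_of_notMem h]

theorem finite_support_dirac {S : Type*} [Finite S] (x : S → ℕ) (r : ℝ) :
    {m | (VectorMeasure.dirac x r : SignedMeasure (S → ℕ)) {m} ≠ 0}.Finite :=
  (Set.finite_singleton x).subset fun m hm => by
    by_contra h
    exact hm (VectorMeasure.dirac_apply_of_notMem fun h' => h (by simpa using h'.symm))

theorem finite_support_add {S : Type*} {μ ν : SignedMeasure (S → ℕ)}
    (hμ : {m | μ {m} ≠ 0}.Finite) (hν : {m | ν {m} ≠ 0}.Finite) :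
    {m | (μ + ν) {m} ≠ 0}.Finite :=
  (hμ.union hν).subset fun m hm => by
    by_contra h
    simp only [Set.mem_union, Set.mem_ofPred_eq, not_or, not_not] at h
    exact hm (by simp [h.1, h.2])

theorem finite_support_sum {S : Type*} {ι : Type*} (F : Finset ι)
    (μ : ι → SignedMeasure (S → ℕ)) (h : ∀ i ∈ F, {m | μ i {m} ≠ 0}.Finite) :
    {m | (∑ i ∈ F, μ i) {m} ≠ 0}.Finite := by
  classical
  induction F using Finset.induction_on with
  | empty => simp
  | insert a F ha ih =>
    rw [Finset.sum_insert ha]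
    exact finite_support_add (h a (by simp)) (ih fun i hi => h i (by simp [hi]))

/-- The algebra of finite signed measures on `ℕ^S` with finite support. -/
def FinSupp : Subalgebra ℝ (SignedMeasure (S → ℕ)) where
  carrier := {μ | {m | μ {m} ≠ 0}.Finite}
  mul_mem' := by
    intro μ ν hμ hν
    change {m | (μ * ν) {m} ≠ 0}.Finite
    rw [eq_sum_dirac μ hμ, eq_sum_dirac ν hν, Finset.sum_mul_sum]
    refine finite_support_sum _ _ fun i _ => finite_support_sum _ _ fun j _ => ?_
    rw [dirac_mul]
    exact finite_support_dirac _ _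
  add_mem' := finite_support_add
  algebraMap_mem' r := by
    rw [Algebra.algebraMap_eq_smul_one]
    change {m | (r • VectorMeasure.dirac 0 1 : SignedMeasure (S → ℕ)) {m} ≠ 0}.Finite
    rw [← dirac_eq_smul]
    exact finite_support_dirac _ _

open scoped Classical in
/-- The algebra morphism `φ_S` from `ℝ[S]` that maps `s` to the point mass at the one-element
multiset `{s}`. -/
def phiHom : MvPolynomial S ℝ →ₐ[ℝ] FinSupp S :=
  MvPolynomial.aeval fun s => ⟨VectorMeasure.dirac (Pi.single s 1) 1, finite_support_dirac _ _⟩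

theorem dirac_pow {X : Type*} [MeasurableSpace X] [AddCommMonoid X] [MeasurableAdd₂ X]
    (x : X) (k : ℕ) :
    (VectorMeasure.dirac x 1 : SignedMeasure X) ^ k = VectorMeasure.dirac (k • x) 1 := by
  induction k with
  | zero => rw [pow_zero, zero_smul]; rfl
  | succ k ih => rw [pow_succ, ih, dirac_mul, one_mul, succ_nsmul]

theorem phiHom_monomial (m : S →₀ ℕ) (r : ℝ) :
    (phiHom S (MvPolynomial.monomial m r) : SignedMeasure (S → ℕ)) =
      VectorMeasure.dirac (m : S → ℕ) r := by
  classical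
  induction m using Finsupp.induction generalizing r with
  | zero =>
    rw [← MvPolynomial.C_apply, ← MvPolynomial.algebraMap_eq, AlgHom.commutes,
      Subalgebra.coe_algebraMap, Algebra.algebraMap_eq_smul_one, dirac_eq_smul]
    rfl
  | single_add s k m _ _ ih =>
    have : MvPolynomial.monomial (Finsupp.single s k + m) r =
        (MvPolynomial.X s) ^ k * MvPolynomial.monomial m r := by
      rw [MvPolynomial.X_pow_eq_monomial, MvPolynomial.monomial_mul, one_mul]
    rw [this, map_mul, map_pow, Subalgebra.coe_mul, ih, Subalgebra.coe_pow]
    have h2 : (phiHom S (MvPolynomial.X s) : SignedMeasure (S → ℕ)) =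
        VectorMeasure.dirac (Pi.single s 1) 1 := by
      simp only [phiHom, MvPolynomial.aeval_X]
    rw [h2, dirac_pow, dirac_mul, one_mul]
    congr 1
    ext t
    by_cases h : t = s
    · subst h; simp
    · simp [h]

theorem phiHom_apply (p : MvPolynomial S ℝ) (m : S →₀ ℕ) :
    (phiHom S p : SignedMeasure (S → ℕ)) {(m : S → ℕ)} = p.coeff m := by
  classical
  induction p using MvPolynomial.induction_on' with
  | monomial u a =>
    rw [phiHom_monomial, MvPolynomial.coeff_monomial]
    split_ifs with h
    · exact VectorMeasure.dirac_apply_of_mem (measurableSet_singleton _) (by simp [h])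
    · exact VectorMeasure.dirac_apply_of_notMem (by simpa [DFunLike.coe_fn_eq] using h)
  | add p q hp hq => rw [map_add, MvPolynomial.coeff_add, ← hp, ← hq]; rfl

theorem phiHom_bijective : Function.Bijective (phiHom S) := by
  constructor
  · intro p q h
    ext m
    rw [← phiHom_apply, ← phiHom_apply, h]
  · rintro ⟨μ, hμ⟩
    refine ⟨∑ m ∈ Set.Finite.toFinset hμ,
      MvPolynomial.monomial (Finsupp.equivFunOnFinite.symm m) (μ {m}), Subtype.ext ?_⟩
    rw [map_sum, AddSubmonoidClass.coe_finsetSum]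
    refine Eq.trans ?_ (eq_sum_dirac μ hμ).symm
    refine Finset.sum_congr rfl fun m _ => ?_
    rw [phiHom_monomial]
    rfl

/-- The isomorphism `φ_S` between `ℝ[S]` and the finitely supported signed measures on `ℕ^S`. -/
def phi : MvPolynomial S ℝ ≃ₐ[ℝ] FinSupp S :=
  AlgEquiv.ofBijective (phiHom S) (phiHom_bijective S)

end FiniteSupport

section WordAlgebras

/-- An algebra over `ℝ` with an action of the word monoid `Λ^*` by algebra endomorphisms and a
distinguished element `ε`. -/
class WordAlgebra (Λ : Type*) (V : Type*) [CommRing V] [Algebra ℝ V] where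
  act : List Λ → V →ₐ[ℝ] V
  act_nil : act [] = AlgHom.id ℝ V
  act_append : ∀ x y, act (x ++ y) = (act x).comp (act y)
  eps : V

variable {Λ : Type*} {S : Type*}

/-- The action of a word on multisets of words: `(x · α)(x z) = α z`, and `x · α` vanishes
on words that do not have `x` as a prefix. -/
def shift (x : List Λ) : (List Λ → ℕ) →+ (List Λ → ℕ) where
  toFun α y := open scoped Classical in if x <+: y then α (y.drop x.length) else 0
  map_zero' := by ext; simp
  map_add' α β := by
    ext y
    simp only [Pi.add_apply]
    split_ifs <;> rfl

theorem measurable_shift (x : List Λ) : Measurable (shift x) := by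
  classical
  refine measurable_pi_lambda _ fun y => ?_
  change Measurable fun α : List Λ → ℕ => if x <+: y then α (y.drop x.length) else 0
  split_ifs
  · exact measurable_pi_apply _
  · exact measurable_const

theorem shift_append (x y : List Λ) (α : List Λ → ℕ) :
    shift (x ++ y) α = shift x (shift y α) := by
  classical
  ext w
  change (if x ++ y <+: w then α (w.drop (x ++ y).length) else 0) =
    if x <+: w then (if y <+: w.drop x.length then α ((w.drop x.length).drop y.length) else 0)
      else 0
  by_cases h : x <+: w
  · obtain ⟨z, rfl⟩ := h
    simp [List.prefix_append_right_inj]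
  · rw [if_neg h, if_neg fun h' => h ((List.prefix_append x y).trans h')]

/-- The algebra of finite signed measures on multisets of words, with `x · μ` the pushforward
of `μ` under `x · -`, and `ε` the point mass at the multiset `{[]}`. The product σ-algebra on
`List Λ → ℕ` is the one generated by the sets of multisets with prescribed values on a finite
tree. -/
instance instWordAlgebraSignedMeasure : WordAlgebra Λ (SignedMeasure (List Λ → ℕ)) where
  act x := pushforward (shift x) (measurable_shift x)
  act_nil := by
    ext1 μ
    have : (shift ([] : List Λ) : (List Λ → ℕ) → (List Λ → ℕ)) = id := by
      ext α y; simp [shift]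
    rw [pushforward_apply, this, VectorMeasure.map_id]
    rfl
  act_append x y := by
    ext1 μ
    rw [AlgHom.comp_apply, pushforward_apply, pushforward_apply, pushforward_apply,
      map_map _ (measurable_shift y) (measurable_shift x)]
    congr 1
    ext1 α
    exact shift_append x y α
  eps := open scoped Classical in VectorMeasure.dirac (Pi.single [] 1) 1

/-- The real numbers with the trivial action and `ε = 1`. -/
instance instWordAlgebraReal : WordAlgebra Λ ℝ where
  act _ := AlgHom.id ℝ ℝ
  act_nil := rfl
  act_append _ _ := rfl
  eps := 1

/-- The polynomials in the indeterminates `x · ε` (written `Sum.inl x`) and `x · s`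
(written `Sum.inr (x, s)`), for words `x` and `s ∈ S`. -/
abbrev Free (Λ S : Type*) := MvPolynomial (List Λ ⊕ (List Λ × S)) ℝ

/-- The free word algebra on `S`: words act on the indeterminates by concatenation. -/
instance instWordAlgebraFree : WordAlgebra Λ (Free Λ S) where
  act x := MvPolynomial.rename (Sum.map (fun y => x ++ y) (fun z => (x ++ z.1, z.2)))
  act_nil := by
    ext i
    rcases i with i | i <;> simp
  act_append x y := by
    ext i
    rcases i with i | i <;> simp
  eps := MvPolynomial.X (Sum.inl [])

/-- The morphism `f^‡` of word algebras from the free algebra extending `f : S → V`. -/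
def lift {V : Type*} [CommRing V] [Algebra ℝ V] [WordAlgebra Λ V] (f : S → V) :
    Free Λ S →ₐ[ℝ] V :=
  MvPolynomial.aeval (Sum.elim (fun x => WordAlgebra.act x (WordAlgebra.eps Λ))
    (fun z => WordAlgebra.act z.1 (f z.2)))

/-- The inclusion of `ℝ[S]` in the free word algebra. -/
def incl (Λ S : Type*) : MvPolynomial S ℝ →ₐ[ℝ] Free Λ S :=
  MvPolynomial.rename fun s => Sum.inr ([], s)

/-- The morphism `𝟙` of word algebras that maps every `s ∈ S` to `1`. -/
def bone (Λ S : Type*) : Free Λ S →ₐ[ℝ] ℝ :=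
  lift fun _ => 1

/-- The partial evaluation `B · h`, with values in `V[Λ^* · S]`: it maps `x · z` to `x · h(z)` for
`x ∈ B` and `z ∈ Λ^* · S`, and `y · ε` to `h(y · ε)`, and fixes the other indeterminates. The
word `x` is unique when the words in `B` are pairwise prefix-incomparable. -/
def partialEval {V : Type*} [CommRing V] [Algebra ℝ V] [WordAlgebra Λ V]
    (B : Set (List Λ)) (h : Free Λ S →ₐ[ℝ] V) :
    Free Λ S →ₐ[ℝ] MvPolynomial (List Λ × S) V :=
  open scoped Classical in
  MvPolynomial.aeval (Sum.elim (fun y => MvPolynomial.C (h (MvPolynomial.X (Sum.inl y))))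
    (fun w => if H : ∃ x ∈ B, x <+: w.1 then
        MvPolynomial.C (WordAlgebra.act H.choose
          (h (MvPolynomial.X (Sum.inr (w.1.drop H.choose.length, w.2)))))
      else MvPolynomial.X w))

/-- The identification of the indeterminates of `V[Λ^* · S]` with elements of `V` when `V` is
the free word algebra on `S`. -/
def flatten : MvPolynomial (List Λ × S) (Free Λ S) →ₐ[ℝ] Free Λ S :=
  (MvPolynomial.aeval (R := Free Λ S) fun w => MvPolynomial.X (Sum.inr w)).restrictScalars ℝ

end WordAlgebras

section Trees

variable {Λ : Type*}

/-- Finite trees: finite prefix-closed sets of words. -/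
def IsTree (A : Finset (List Λ)) : Prop :=
  ∀ x ∈ A, ∀ y, y <+: x → y ∈ A

/-- `∂A`: the prefix-minimal words outside `A`. -/
def boundary (A : Finset (List Λ)) : Set (List Λ) :=
  {x | x ∉ A ∧ ∀ y, y <+: x → y ∉ A → y = x}

end Trees

/-- An automaton: each state is mapped to a finitely supported probability distribution on
monomials in `ε` (written `none`) and `a · s` (written `some (a, s)`), that is, to a polynomial
in `ℝ[ε, Λ · S]` with nonnegative coefficients of sum one. -/
structure Automaton (Λ S : Type*) where
  trans : S → MvPolynomial (Option (Λ × S)) ℝ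
  coeff_nonneg : ∀ s m, 0 ≤ (trans s).coeff m
  sum_coeff : ∀ s, ∑ m ∈ (trans s).support, (trans s).coeff m = 1

section Automata

variable {Λ S : Type*} (M : Automaton Λ S)

/-- The structure map `θ`, with `ℝ[ε, Λ · S]` regarded as part of the free word algebra. -/
def theta (s : S) : Free Λ S :=
  MvPolynomial.rename (fun i => i.elim (Sum.inl []) fun z => Sum.inr ([z.1], z.2)) (M.trans s)

/-- The map `f`, with values in the probability measures on multisets of words, is a fixed
point of `f ↦ f^‡ ∘ θ`. -/
def IsSemantics (f : S → ProbabilityMeasure (List Λ → ℕ)) : Prop :=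
  ∀ s, (f s : Measure (List Λ → ℕ)).toSignedMeasure =
    lift (fun t => (f t : Measure (List Λ → ℕ)).toSignedMeasure) (theta M s)

/-- The extension of a semantic map `f` to the finitely supported signed measures on `ℕ^S`,
along `φ_S`. -/
def semExt [Finite S] (f : S → ProbabilityMeasure (List Λ → ℕ)) (μ : FinSupp S) :
    SignedMeasure (List Λ → ℕ) :=
  lift (fun t => (f t : Measure (List Λ → ℕ)).toSignedMeasure) (incl Λ S ((phi S).symm μ))

/-- The endomorphism `x · θ` of the free word algebra. -/
def thetaAt (x : List Λ) : Free Λ S →ₐ[ℝ] Free Λ S :=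
  flatten.comp (partialEval {x} (lift (theta M)))

open scoped Classical in
/-- The extension `θ_A` of the structure map to a finite tree `A`: it is the identity for
`A = ∅`, and `θ_{A ∪ {x}} = (x · θ) ∘ θ_A` for `x ∈ ∂A`. Here the last step is made at a word
of maximal length; see `thetaTree_insert`. -/
def thetaTree (A : Finset (List Λ)) : MvPolynomial S ℝ →ₐ[ℝ] Free Λ S :=
  if h : A.Nonempty then
    (thetaAt M (A.exists_max_image List.length h).choose).comp
      (thetaTree (A.erase (A.exists_max_image List.length h).choose))
  else incl Λ S
termination_by A.card
decreasing_by
  exact Finset.card_erase_lt_of_mem (A.exists_max_image List.length h).choose_spec.1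

/-- `d_A^m(p)`: the coefficient of the monomial `m` in `θ_A(p)`, regarded as a polynomial in the
indeterminates `y · ε` with coefficients in `ℝ[Λ^* · S]`. The exponents of `m` are given by a
finitely supported function on words. -/
def dTree (A : Finset (List Λ)) (m : List Λ →₀ ℕ) (p : MvPolynomial S ℝ) :
    MvPolynomial (List Λ × S) ℝ :=
  (MvPolynomial.sumAlgEquiv ℝ (List Λ) (List Λ × S) (thetaTree M A p)).coeff m

/-- `((∂A ∖ x) · 𝟙)(d_A^m(p))`. -/
def dTreeOne (A : Finset (List Λ)) (x : List Λ) (m : List Λ →₀ ℕ) (p : MvPolynomial S ℝ) :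
    MvPolynomial (List Λ × S) ℝ :=
  partialEval (boundary A \ {x}) (bone Λ S) (MvPolynomial.rename Sum.inr (dTree M A m p))

/-- `d_{A,x}^m(p)`: the polynomial `q ∈ ℝ[S]` with `x · q = ((∂A ∖ x) · 𝟙)(d_A^m(p))`; see
`dAt_spec`. -/
def dAt (A : Finset (List Λ)) (x : List Λ) (m : List Λ →₀ ℕ) (p : MvPolynomial S ℝ) :
    MvPolynomial S ℝ :=
  MvPolynomial.killCompl (Prod.mk_right_injective x) (dTreeOne M A x m p)

theorem thetaTree_empty : thetaTree M ∅ = incl Λ S := by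
  rw [thetaTree]
  simp

theorem thetaAt_eps (x y : List Λ) :
    thetaAt M x (MvPolynomial.X (Sum.inl y)) = MvPolynomial.X (Sum.inl y) := by
  simp [thetaAt, partialEval, flatten, lift, WordAlgebra.act, WordAlgebra.eps]

theorem thetaAt_of_not_prefix {x w : List Λ} (s : S) (h : ¬ x <+: w) :
    thetaAt M x (MvPolynomial.X (Sum.inr (w, s))) = MvPolynomial.X (Sum.inr (w, s)) := by
  simp [thetaAt, partialEval, flatten, h]

theorem thetaAt_of_prefix {x w : List Λ} (s : S) (h : x <+: w) :
    thetaAt M x (MvPolynomial.X (Sum.inr (w, s))) = WordAlgebra.act w (theta M s) := by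
  have H : ∃ y ∈ ({x} : Set (List Λ)), y <+: w := ⟨x, rfl, h⟩
  have hx : H.choose = x := H.choose_spec.1
  obtain ⟨z, rfl⟩ := h
  simp only [thetaAt, partialEval, AlgHom.comp_apply, MvPolynomial.aeval_X, Sum.elim_inr,
    dif_pos H, hx, List.drop_left, lift, flatten, AlgHom.restrictScalars_apply,
    MvPolynomial.aeval_C, WordAlgebra.act_append]
  rfl

theorem hom_congr {σ V : Type*} [CommRing V] [Algebra ℝ V] {I : Set σ}
    {f g : MvPolynomial σ ℝ →ₐ[ℝ] V} (h : ∀ i ∈ I, f (MvPolynomial.X i) = g (MvPolynomial.X i))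
    {p : MvPolynomial σ ℝ} (hp : p ∈ MvPolynomial.supported ℝ I) : f p = g p := by
  have : MvPolynomial.supported ℝ I ≤ AlgHom.equalizer f g :=
    Algebra.adjoin_le (by rintro _ ⟨i, hi, rfl⟩; exact h i hi)
  exact this hp

theorem hom_mem {σ V : Type*} [CommRing V] [Algebra ℝ V] {I : Set σ} {T : Subalgebra ℝ V}
    {f : MvPolynomial σ ℝ →ₐ[ℝ] V} (h : ∀ i ∈ I, f (MvPolynomial.X i) ∈ T)
    {p : MvPolynomial σ ℝ} (hp : p ∈ MvPolynomial.supported ℝ I) : f p ∈ T := by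
  have : MvPolynomial.supported ℝ I ≤ T.comap f :=
    Algebra.adjoin_le (by rintro _ ⟨i, hi, rfl⟩; exact h i hi)
  exact this hp

/-- The polynomial `w · θ(s)` only involves `w · ε` and the `w a · t`. -/
theorem act_theta_mem (w : List Λ) (s : S) :
    WordAlgebra.act w (theta M s) ∈ MvPolynomial.supported ℝ
      ({i | i = Sum.inl w ∨ ∃ a t, i = Sum.inr (w ++ [a], t)} :
        Set (List Λ ⊕ (List Λ × S))) := by
  refine hom_mem (f := (WordAlgebra.act w).comp (MvPolynomial.rename _)) (I := Set.univ) ?_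
    (p := M.trans s) (by rw [MvPolynomial.supported_univ]; trivial)
  rintro (_ | ⟨a, t⟩) -
  · simp only [AlgHom.comp_apply, MvPolynomial.rename_X, WordAlgebra.act, Option.elim,
      Sum.map_inl, List.append_nil]
    exact MvPolynomial.X_mem_supported.2 (Or.inl rfl)
  · simp only [AlgHom.comp_apply, MvPolynomial.rename_X, WordAlgebra.act, Option.elim,
      Sum.map_inr]
    exact MvPolynomial.X_mem_supported.2 (Or.inr ⟨a, t, rfl⟩)

theorem thetaAt_act_theta {x w : List Λ} (s : S) (h : ∀ a, ¬ x <+: w ++ [a]) :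
    thetaAt M x (WordAlgebra.act w (theta M s)) = WordAlgebra.act w (theta M s) := by
  refine hom_congr (g := AlgHom.id ℝ _) ?_ (act_theta_mem M w s)
  rintro _ (rfl | ⟨a, t, rfl⟩)
  · exact thetaAt_eps M x w
  · exact thetaAt_of_not_prefix M t (h a)

theorem thetaAt_comm {x y : List Λ} (hxy : ¬ x <+: y) (hyx : ¬ y <+: x) :
    (thetaAt M x).comp (thetaAt M y) = (thetaAt M y).comp (thetaAt M x) := by
  have key : ∀ {x y : List Λ}, ¬ x <+: y → ¬ y <+: x → ∀ (w : List Λ) (s : S), x <+: w →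
      thetaAt M y (thetaAt M x (MvPolynomial.X (Sum.inr (w, s)))) =
        thetaAt M x (thetaAt M y (MvPolynomial.X (Sum.inr (w, s)))) := by
    intro x y hxy hyx w s hw
    have h : ∀ v, x <+: v → ¬ y <+: v := fun v h₁ h₂ =>
      (List.prefix_or_prefix_of_prefix h₁ h₂).elim hxy hyx
    rw [thetaAt_of_not_prefix M s (h w hw), thetaAt_of_prefix M s hw,
      thetaAt_act_theta M s fun a => h _ (hw.trans (List.prefix_append _ _))]
  refine MvPolynomial.algHom_ext fun i => ?_
  rcases i with w | ⟨w, s⟩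
  · simp only [AlgHom.comp_apply, thetaAt_eps]
  · simp only [AlgHom.comp_apply]
    by_cases h₁ : x <+: w
    · exact (key hxy hyx w s h₁).symm
    · by_cases h₂ : y <+: w
      · exact key hyx hxy w s h₂
      · rw [thetaAt_of_not_prefix M s h₂, thetaAt_of_not_prefix M s h₁,
          thetaAt_of_not_prefix M s h₂]

theorem isTree_erase [DecidableEq (List Λ)] {A : Finset (List Λ)} (hA : IsTree A) {x : List Λ}
    (hx : ∀ y ∈ A, y.length ≤ x.length) : IsTree (A.erase x) := by
  intro y hy z hz
  rw [Finset.mem_erase] at hy ⊢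
  refine ⟨?_, hA y hy.2 z hz⟩
  rintro rfl
  exact hy.1 (hz.eq_of_length_le (hx y hy.2)).symm

theorem mem_boundary_erase [DecidableEq (List Λ)] {A : Finset (List Λ)} (hA : IsTree A)
    {x : List Λ} (hx : x ∈ A) : x ∈ boundary (A.erase x) := by
  refine ⟨by simp, fun y hy hyA => ?_⟩
  by_contra h
  exact hyA (Finset.mem_erase.2 ⟨h, hA x hx y hy⟩)

theorem isTree_insert [DecidableEq (List Λ)] {A : Finset (List Λ)} (hA : IsTree A)
    {x : List Λ} (hx : x ∈ boundary A) : IsTree (insert x A) := by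
  intro y hy z hz
  rw [Finset.mem_insert] at hy ⊢
  rcases hy with rfl | hy
  · by_cases h : z ∈ A
    · exact Or.inr h
    · exact Or.inl (hx.2 z hz h)
  · exact Or.inr (hA y hy z hz)

theorem thetaTree_eq [DecidableEq (List Λ)] {A : Finset (List Λ)} (h : A.Nonempty) :
    ∃ x ∈ A, (∀ y ∈ A, y.length ≤ x.length) ∧
      thetaTree M A = (thetaAt M x).comp (thetaTree M (A.erase x)) := by
  refine ⟨_, (A.exists_max_image List.length h).choose_spec.1,
    (A.exists_max_image List.length h).choose_spec.2, ?_⟩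
  rw [thetaTree, dif_pos h]
  congr!

/-- The order in which a tree is built does not matter. -/
theorem thetaTree_insert [DecidableEq (List Λ)] (A : Finset (List Λ)) (hA : IsTree A)
    (x : List Λ) (hx : x ∈ boundary A) :
    thetaTree M (insert x A) = (thetaAt M x).comp (thetaTree M A) := by
  induction hn : A.card using Nat.strong_induction_on generalizing A x with
  | _ n ih =>
    obtain ⟨z, hz, hmax, h⟩ := thetaTree_eq M (Finset.insert_nonempty x A)
    rw [h]
    by_cases hzx : z = x
    · subst hzx
      rw [Finset.erase_insert hx.1]
    · have hzA : z ∈ A := (Finset.mem_insert.1 hz).resolve_left hzx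
      have hmaxA : ∀ y ∈ A, y.length ≤ z.length := fun y hy =>
        hmax y (Finset.mem_insert_of_mem hy)
      have hA' := isTree_erase hA hmaxA
      have hzx' : ¬ z <+: x := fun hp =>
        hzx (hp.eq_of_length_le (hmax x (Finset.mem_insert_self x A)))
      have hxz' : ¬ x <+: z := fun hp => hx.1 (hA z hzA x hp)
      have hx' : x ∈ boundary (A.erase z) := by
        refine ⟨fun h => hx.1 (Finset.mem_of_mem_erase h), fun y hy hyA => ?_⟩
        refine hx.2 y hy fun h => hyA (Finset.mem_erase.2 ⟨?_, h⟩)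
        rintro rfl
        exact hzx' hy
      have hcard : (A.erase z).card < n := hn ▸ Finset.card_erase_lt_of_mem hzA
      rw [Finset.erase_insert_of_ne (Ne.symm hzx), ih _ hcard _ hA' x hx' rfl, ← AlgHom.comp_assoc,
        thetaAt_comm M hzx' hxz', AlgHom.comp_assoc,
        ← ih _ hcard _ hA' z (mem_boundary_erase hA hzA) rfl, Finset.insert_erase hzA]

/-- The invariant `θ_A(p) ∈ ℝ[A · ε, ∂A · S]`. -/
theorem thetaTree_mem (A : Finset (List Λ)) (hA : IsTree A) (p : MvPolynomial S ℝ) :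
    thetaTree M A p ∈ MvPolynomial.supported ℝ
      ({i | (∃ y ∈ A, i = Sum.inl y) ∨ ∃ y ∈ boundary A, ∃ t, i = Sum.inr (y, t)} :
        Set (List Λ ⊕ (List Λ × S))) := by
  classical
  induction hn : A.card using Nat.strong_induction_on generalizing A with
  | _ n ih =>
    rcases A.eq_empty_or_nonempty with rfl | hne
    · rw [thetaTree_empty]
      refine hom_mem (I := Set.univ) ?_ (by rw [MvPolynomial.supported_univ]; trivial)
      intro s _
      rw [incl, MvPolynomial.rename_X]
      exact MvPolynomial.X_mem_supported.2
        (Or.inr ⟨[], ⟨by simp, fun y hy _ => List.prefix_nil.1 hy⟩, s, rfl⟩)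
    · obtain ⟨x, hx, hmax, h⟩ := thetaTree_eq M hne
      have hcard : (A.erase x).card < n := hn ▸ Finset.card_erase_lt_of_mem hx
      rw [h, AlgHom.comp_apply]
      refine hom_mem ?_ (ih _ hcard _ (isTree_erase hA hmax) rfl)
      rintro _ (⟨y, hy, rfl⟩ | ⟨y, hy, t, rfl⟩)
      · rw [thetaAt_eps]
        exact MvPolynomial.X_mem_supported.2 (Or.inl ⟨y, Finset.mem_of_mem_erase hy, rfl⟩)
      · by_cases hxy : x <+: y
        · obtain rfl : x = y := hy.2 x hxy (by simp)
          rw [thetaAt_of_prefix M t hxy]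
          refine MvPolynomial.supported_mono ?_ (act_theta_mem M x t)
          rintro _ (rfl | ⟨a, t, rfl⟩)
          · exact Or.inl ⟨x, hx, rfl⟩
          · refine Or.inr ⟨x ++ [a], ⟨fun hmem => ?_, fun z hz hzA => ?_⟩, t, rfl⟩
            · have := hmax _ hmem
              simp at this
            · rcases List.prefix_concat_iff.1 hz with h | h
              · exact h
              · exact absurd (hA x hx z h) hzA
        · rw [thetaAt_of_not_prefix M t hxy]
          refine MvPolynomial.X_mem_supported.2 (Or.inr ⟨y, ⟨fun hyA => hy.1 ?_, ?_⟩, t, rfl⟩)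
          · exact Finset.mem_erase.2 ⟨fun h => hxy (h ▸ List.prefix_refl _), hyA⟩
          · exact fun z hz hzA => hy.2 z hz fun h => hzA (Finset.mem_of_mem_erase h)

/-- The defining equation of `d_{A,x}^m(p)`. -/
theorem dAt_spec (A : Finset (List Λ)) (hA : IsTree A) (x : List Λ)
    (m : List Λ →₀ ℕ) (p : MvPolynomial S ℝ) :
    MvPolynomial.rename (fun s => (x, s)) (dAt M A x m p) = dTreeOne M A x m p := by
  have h₁ : ∀ q ∈ MvPolynomial.supported ℝ
      ({i | (∃ y ∈ A, i = Sum.inl y) ∨ ∃ y ∈ boundary A, ∃ t, i = Sum.inr (y, t)} :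
        Set (List Λ ⊕ (List Λ × S))), ∀ m : List Λ →₀ ℕ,
      (MvPolynomial.sumAlgEquiv ℝ (List Λ) (List Λ × S) q).coeff m ∈
        MvPolynomial.supported ℝ {i : List Λ × S | i.1 ∈ boundary A} := by
    classical
    let U := MvPolynomial.supported ℝ {i : List Λ × S | i.1 ∈ boundary A}
    let T : Subalgebra ℝ (MvPolynomial (List Λ) (MvPolynomial (List Λ × S) ℝ)) :=
      { carrier := {q | ∀ m, q.coeff m ∈ U}
        mul_mem' := fun {f g} hf hg m => by
          rw [MvPolynomial.coeff_mul]
          exact sum_mem fun z _ => mul_mem (hf _) (hg _)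
        add_mem' := fun {f g} hf hg m => by
          rw [MvPolynomial.coeff_add]
          exact add_mem (hf _) (hg _)
        algebraMap_mem' := fun r m => by
          rw [MvPolynomial.algebraMap_apply, MvPolynomial.coeff_C]
          split_ifs
          · exact U.algebraMap_mem r
          · exact zero_mem U }
    intro q hq
    refine hom_mem (f := (MvPolynomial.sumAlgEquiv ℝ (List Λ) (List Λ × S)).toAlgHom) (T := T)
      ?_ hq
    rintro _ (⟨y, hy, rfl⟩ | ⟨y, hy, t, rfl⟩) m
    · change (MvPolynomial.sumAlgEquiv ℝ (List Λ) (List Λ × S)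
        (MvPolynomial.X (Sum.inl y))).coeff m ∈ U
      rw [MvPolynomial.sumAlgEquiv_X_inl, MvPolynomial.coeff_X]
      split_ifs
      · exact one_mem U
      · exact zero_mem U
    · change (MvPolynomial.sumAlgEquiv ℝ (List Λ) (List Λ × S)
        (MvPolynomial.X (Sum.inr (y, t)))).coeff m ∈ U
      rw [MvPolynomial.sumAlgEquiv_X_inr, MvPolynomial.coeff_C]
      split_ifs
      · exact MvPolynomial.X_mem_supported.2 hy
      · exact zero_mem U
  have h₂ : dTreeOne M A x m p ∈
      (MvPolynomial.rename (R := ℝ) fun s : S => (x, s)).range := by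
    refine hom_mem (f := (partialEval (boundary A \ {x}) (bone Λ S)).comp
      (MvPolynomial.rename Sum.inr)) ?_ (h₁ _ (thetaTree_mem M A hA p) m)
    rintro ⟨y, s⟩ hy
    simp only [AlgHom.comp_apply, MvPolynomial.rename_X, partialEval, MvPolynomial.aeval_X,
      Sum.elim_inr]
    split_ifs with H
    · exact Subalgebra.algebraMap_mem _ _
    · obtain rfl : y = x := by
        by_contra hne
        exact H ⟨y, ⟨hy, hne⟩, List.prefix_refl _⟩
      exact ⟨MvPolynomial.X s, MvPolynomial.rename_X _ _⟩
  obtain ⟨q, hq⟩ := h₂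
  rw [dAt, ← hq]
  exact congrArg _ (MvPolynomial.killCompl_rename_app _ q)

end Automata
end
end PKA

/-!
A signed measure on multisets of words is determined by its marginals on finite sets of words. The
marginal of `f^‡(θ(s))` on the words of length less than `n + 1` depends only on the marginals of
`f` on the words of length less than `n`. So two semantics agree on words of every length, and the
iterates of `f ↦ f^‡ ∘ θ` form a consistent sequence of marginals, whose projective limit is a
semantics.

For a finite tree `A`, the polynomials `p` and `θ_A(p)` have the same semantics. The indeterminates
`x · s` in `θ_A(p)` have `x ∈ ∂A`, and a multiset shifted by such an `x` vanishes on `A`; the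
marginal on `A` therefore does not change when they are all replaced by `1`. What remains is a
polynomial in the `y · ε` with `y ∈ A`. Its coefficients are the numbers `𝟙(d_{A,x}^m(p))`, and it
vanishes exactly when its image under the injective map `φ` does.
-/

namespace PKA

noncomputable section

section ProbabilityMeasures

variable {X Y : Type*} [MeasurableSpace X] [MeasurableSpace Y]

theorem toSignedMeasure_map (P : Measure X) [IsFiniteMeasure P] {f : X → Y} (hf : Measurable f) :
    P.toSignedMeasure.map f = (P.map f).toSignedMeasure := by
  ext s hs
  rw [VectorMeasure.map_apply _ hf hs, Measure.toSignedMeasure_apply_measurable hs,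
    Measure.toSignedMeasure_apply_measurable (hf hs), map_measureReal_apply hf hs]

theorem tensor_toSignedMeasure (P : Measure X) [IsFiniteMeasure P] (Q : Measure Y)
    [IsFiniteMeasure Q] :
    tensor P.toSignedMeasure Q.toSignedMeasure = (P.prod Q).toSignedMeasure :=
  tensor_eq fun s t hs ht => by
    rw [Measure.toSignedMeasure_apply_measurable (hs.prod ht),
      Measure.toSignedMeasure_apply_measurable hs, Measure.toSignedMeasure_apply_measurable ht,
      measureReal_prod_prod]

theorem toSignedMeasure_dirac (x : X) :
    (Measure.dirac x).toSignedMeasure = VectorMeasure.dirac x 1 := by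
  ext s hs
  rw [Measure.toSignedMeasure_apply_measurable hs, measureReal_def, Measure.dirac_apply' _ hs]
  by_cases h : x ∈ s
  · simp [h, VectorMeasure.dirac_apply_of_mem hs h]
  · simp [h, VectorMeasure.dirac_apply_of_notMem h]

/-- A signed measure that comes from a probability measure. A predicate, rather than a type, lets
probability measures be combined with the algebra operations on signed measures. -/
def IsProb (μ : SignedMeasure X) : Prop :=
  ∃ P : ProbabilityMeasure X, (P : Measure X).toSignedMeasure = μ

theorem isProb_iff {μ : SignedMeasure X} : IsProb μ ↔ 0 ≤ μ ∧ μ Set.univ = 1 := by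
  refine ⟨?_, fun ⟨hμ, huniv⟩ => ?_⟩
  · rintro ⟨P, rfl⟩
    exact ⟨Measure.zero_le_toSignedMeasure _, by simp⟩
  · rw [← VectorMeasure.le_restrict_univ_iff_le] at hμ
    have h := SignedMeasure.toMeasureOfZeroLE_toSignedMeasure μ hμ
    refine ⟨⟨μ.toMeasureOfZeroLE Set.univ MeasurableSet.univ hμ, ⟨?_⟩⟩, h⟩
    rw [← ENNReal.toReal_eq_one_iff, ← measureReal_def,
      ← Measure.toSignedMeasure_apply_measurable MeasurableSet.univ, h, huniv]

theorem IsProb.map {μ : SignedMeasure X} (hμ : IsProb μ) {f : X → Y} (hf : Measurable f) :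
    IsProb (μ.map f) := by
  obtain ⟨P, rfl⟩ := hμ
  exact ⟨P.map hf.aemeasurable, (toSignedMeasure_map _ hf).symm⟩

theorem isProb_dirac (x : X) : IsProb (VectorMeasure.dirac x 1 : SignedMeasure X) :=
  ⟨⟨Measure.dirac x, inferInstance⟩, toSignedMeasure_dirac x⟩

theorem IsProb.map_const {μ : SignedMeasure X} (hμ : IsProb μ) (y : Y) :
    (μ.map fun _ => y) = VectorMeasure.dirac y 1 := by
  obtain ⟨P, rfl⟩ := hμ
  rw [toSignedMeasure_map _ measurable_const, ← toSignedMeasure_dirac]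
  simp [Measure.map_const]

theorem isProb_sum {ι : Type*} {F : Finset ι} {c : ι → ℝ} {μ : ι → SignedMeasure X}
    (hc : ∀ i ∈ F, 0 ≤ c i) (hc₁ : ∑ i ∈ F, c i = 1) (hμ : ∀ i ∈ F, IsProb (μ i)) :
    IsProb (∑ i ∈ F, c i • μ i) := by
  have sum_apply (s : Set X) : (∑ i ∈ F, c i • μ i) s = ∑ i ∈ F, c i * μ i s := by simp
  refine isProb_iff.2 ⟨VectorMeasure.le_iff.2 fun s hs => ?_, ?_⟩
  · rw [sum_apply]
    exact Finset.sum_nonneg fun i hi =>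
      mul_nonneg (hc i hi) (VectorMeasure.le_iff.1 (isProb_iff.1 (hμ i hi)).1 s hs)
  · rw [sum_apply, ← hc₁]
    exact Finset.sum_congr rfl fun i hi => by rw [(isProb_iff.1 (hμ i hi)).2, mul_one]

variable [AddCommMonoid X] [MeasurableAdd₂ X]

theorem isProb_one : IsProb (1 : SignedMeasure X) :=
  isProb_dirac 0

theorem IsProb.mul {μ ν : SignedMeasure X} (hμ : IsProb μ) (hν : IsProb ν) : IsProb (μ * ν) := by
  obtain ⟨P, rfl⟩ := hμ
  obtain ⟨Q, rfl⟩ := hν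
  change IsProb ((tensor _ _).map _)
  rw [tensor_toSignedMeasure]
  exact IsProb.map ⟨P.prod Q, rfl⟩ measurable_sum_pair

theorem IsProb.pow {μ : SignedMeasure X} (hμ : IsProb μ) (k : ℕ) : IsProb (μ ^ k) := by
  induction k with
  | zero => exact isProb_one
  | succ k ih => exact pow_succ μ k ▸ ih.mul hμ

theorem isProb_aeval {σ : Type*} {p : MvPolynomial σ ℝ} (hp : ∀ m, 0 ≤ p.coeff m)
    (hp₁ : ∑ m ∈ p.support, p.coeff m = 1) {f : σ → SignedMeasure X} (hf : ∀ i, IsProb (f i)) :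
    IsProb (MvPolynomial.aeval f p) := by
  rw [MvPolynomial.aeval_def, MvPolynomial.eval₂_eq]
  simp only [← Algebra.smul_def]
  exact isProb_sum (fun m _ => hp m) hp₁ fun m _ =>
    Finset.prod_induction _ IsProb (fun _ _ => IsProb.mul) isProb_one fun i _ => (hf i).pow _

end ProbabilityMeasures

section ProjectiveLimits

open ProbabilityTheory Preorder

/- Disintegrate `μ (n + 1)` over `μ n`, and let the Ionescu-Tulcea theorem compose the resulting
kernels. -/
theorem exists_measure_map_frestrictLe_eq {X : ℕ → Type*} [∀ n, MeasurableSpace (X n)]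
    [∀ n, StandardBorelSpace (X n)] [∀ n, Nonempty (X n)]
    (μ : ∀ n, Measure (∀ i : Finset.Iic n, X i)) [∀ n, IsProbabilityMeasure (μ n)]
    (hμ : ∀ n, (μ (n + 1)).map (frestrictLe₂ n.le_succ) = μ n) :
    ∃ Q : Measure (∀ n, X n), IsProbabilityMeasure Q ∧ ∀ n, Q.map (frestrictLe n) = μ n := by
  let last (n : ℕ) (x : ∀ i : Finset.Iic (n + 1), X i) : X (n + 1) :=
    x ⟨n + 1, Finset.mem_Iic.2 le_rfl⟩
  let κ (n : ℕ) : Kernel (∀ i : Finset.Iic n, X i) (X (n + 1)) :=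
    condDistrib (last n) (frestrictLe₂ n.le_succ) (μ (n + 1))
  let start := MeasurableEquiv.piUnique fun i : Finset.Iic 0 => X i
  let μ₀ : Measure (X 0) := (μ 0).map start
  have : IsProbabilityMeasure μ₀ := Measure.isProbabilityMeasure_map start.measurable.aemeasurable
  refine ⟨Kernel.trajMeasure μ₀ κ, inferInstance, fun n => ?_⟩
  induction n with
  | zero =>
    rw [Kernel.trajMeasure, Measure.map_comp _ _ (by fun_prop), Kernel.traj_map_frestrictLe,
      Kernel.partialTraj_self, Measure.id_comp]
    exact start.map_symm_map
  | succ n ih =>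
    let split : (∀ i : Finset.Iic (n + 1), X i) ≃ᵐ (∀ i : Finset.Iic n, X i) × X (n + 1) :=
      (MeasurableEquiv.IicProdIoc n.le_succ).symm.trans
        (.prodCongr (.refl _) (MeasurableEquiv.piSingleton n).symm)
    refine split.map_measurableEquiv_injective ?_
    calc ((Kernel.trajMeasure μ₀ κ).map (frestrictLe (n + 1))).map split
        = (Kernel.trajMeasure μ₀ κ).map fun x => (frestrictLe n x, x (n + 1)) :=
          Measure.map_map split.measurable (by fun_prop)
      _ = (Kernel.trajMeasure μ₀ κ).map (frestrictLe n) ⊗ₘ κ n :=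
          Kernel.map_frestrictLe_trajMeasure_compProd_eq_map_trajMeasure.symm
      _ = (μ (n + 1)).map (frestrictLe₂ n.le_succ) ⊗ₘ κ n := by rw [ih, hμ]
      _ = (μ (n + 1)).map split := compProd_map_condDistrib (by fun_prop)

theorem exists_measure_map_domRestrict_eq {ι : Type*} [Countable ι] {X : ι → Type*}
    [∀ i, MeasurableSpace (X i)] [∀ i, StandardBorelSpace (X i)] [∀ i, Nonempty (X i)]
    {B : ℕ → Set ι} (hB : Monotone B) (hcover : ∀ i, ∃ n, i ∈ B n)
    (μ : ℕ → Measure (∀ i, X i)) [∀ n, IsProbabilityMeasure (μ n)]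
    (hμ : ∀ n, (μ (n + 1)).map (B n).domRestrict = (μ n).map (B n).domRestrict) :
    ∃ Q : Measure (∀ i, X i), IsProbabilityMeasure Q ∧
      ∀ n, Q.map (B n).domRestrict = (μ n).map (B n).domRestrict := by
  let blocks (n : ℕ) (x : ∀ i, X i) (k : Finset.Iic n) : ∀ i : B k, X i := (B k).domRestrict x
  have measurable_blocks (n : ℕ) : Measurable (blocks n) := by fun_prop
  have map_blocks (n : ℕ) : (μ (n + 1)).map (blocks n) = (μ n).map (blocks n) := by
    let ofRestrict (y : ∀ i : B n, X i) (k : Finset.Iic n) : ∀ i : B k, X i :=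
      Set.domRestrict₂ (hB (Finset.mem_Iic.1 k.2)) y
    have measurable_ofRestrict : Measurable ofRestrict := by fun_prop
    have := congrArg (Measure.map ofRestrict) (hμ n)
    rwa [Measure.map_map measurable_ofRestrict (by fun_prop),
      Measure.map_map measurable_ofRestrict (by fun_prop)] at this
  have (n : ℕ) : IsProbabilityMeasure ((μ n).map (blocks n)) :=
    Measure.isProbabilityMeasure_map (measurable_blocks n).aemeasurable
  obtain ⟨Q, _, hQ⟩ := exists_measure_map_frestrictLe_eq (X := fun k => ∀ i : B k, X i)
    (fun n => (μ n).map (blocks n)) fun n =>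
      (Measure.map_map (measurable_frestrictLe₂ (X := fun k => ∀ i : B k, X i) n.le_succ)
        (measurable_blocks (n + 1))).trans (map_blocks n)
  classical
  let glue (y : ∀ n, ∀ i : B n, X i) (i : ι) : X i :=
    y (Nat.find (hcover i)) ⟨i, Nat.find_spec (hcover i)⟩
  have measurable_glue : Measurable glue := by fun_prop
  refine ⟨Q.map glue, Measure.isProbabilityMeasure_map measurable_glue.aemeasurable, fun n => ?_⟩
  let glueLe (y : ∀ k : Finset.Iic n, ∀ i : B k, X i) (i : B n) : X i :=
    y ⟨Nat.find (hcover i), Finset.mem_Iic.2 (Nat.find_min' _ i.2)⟩ ⟨i, Nat.find_spec (hcover i)⟩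
  have measurable_glueLe : Measurable glueLe := by fun_prop
  calc (Q.map glue).map (B n).domRestrict
      = (Q.map (frestrictLe n)).map glueLe := by
        rw [Measure.map_map (by fun_prop) measurable_glue,
          Measure.map_map measurable_glueLe (by fun_prop)]
        rfl
    _ = ((μ n).map (blocks n)).map glueLe := by rw [hQ]
    _ = (μ n).map (B n).domRestrict := Measure.map_map measurable_glueLe (measurable_blocks n)

end ProjectiveLimits

section Marginals

variable {ι N : Type*} [MeasurableSpace N] [AddCommMonoid N] [MeasurableAdd₂ N]

/-- The marginal on `B` of a signed measure on families indexed by `ι`: its pushforward under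
restriction of families to `B`. -/
def marginal (B : Set ι) : SignedMeasure (ι → N) →ₐ[ℝ] SignedMeasure (B → N) :=
  pushforward (LinearMap.funLeft ℕ N ((↑) : B → ι)).toAddMonoidHom
    (measurable_pi_lambda _ fun i => measurable_pi_apply (i : ι))

theorem marginal_apply (B : Set ι) (μ : SignedMeasure (ι → N)) :
    marginal B μ = μ.map B.domRestrict := rfl

theorem marginal_map {X : Type*} [MeasurableSpace X] (B : Set ι) (μ : SignedMeasure X)
    {f : X → ι → N} (hf : Measurable f) : marginal B (μ.map f) = μ.map (B.domRestrict ∘ f) :=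
  map_map μ hf (g := B.domRestrict) (by fun_prop)

theorem marginal_toSignedMeasure (B : Set ι) (P : Measure (ι → N)) [IsFiniteMeasure P] :
    marginal B P.toSignedMeasure = (P.map B.domRestrict).toSignedMeasure :=
  toSignedMeasure_map P (f := B.domRestrict) (by fun_prop)

variable {μ ν : SignedMeasure (ι → N)}

theorem marginal_eq_of_subset {B C : Set ι} (hBC : B ⊆ C) (h : marginal C μ = marginal C ν) :
    marginal B μ = marginal B ν := by
  have map_domRestrict₂ (ρ : SignedMeasure (ι → N)) :
      (marginal C ρ).map (Set.domRestrict₂ (π := fun _ => N) hBC) = marginal B ρ :=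
    map_map ρ (f := C.domRestrict) (by fun_prop) <|
      measurable_pi_lambda _ fun i => measurable_pi_apply _
  rw [← map_domRestrict₂, h, map_domRestrict₂]

theorem ext_of_marginal_finset
    (h : ∀ I : Finset ι, marginal (I : Set ι) μ = marginal (I : Set ι) ν) : μ = ν := by
  have eq_on_cylinder (I : Finset ι) {s : Set (I → N)} (hs : MeasurableSet s) :
      μ (cylinder I s) = ν (cylinder I s) := by
    have hI := congrArg (fun ρ : SignedMeasure (I → N) => ρ s) (h I)
    rwa [marginal_apply, marginal_apply, VectorMeasure.map_apply _ (by fun_prop) hs,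
      VectorMeasure.map_apply _ (by fun_prop) hs] at hI
  refine VectorMeasure.ext_of_generateFrom (measurableCylinders fun _ : ι => N) (fun s hs => ?_)
    generateFrom_measurableCylinders.symm isPiSystem_measurableCylinders ?_
  · obtain ⟨I, t, ht, rfl⟩ := (mem_measurableCylinders s).1 hs
    exact eq_on_cylinder I ht
  · simpa using eq_on_cylinder ∅ MeasurableSet.univ

theorem exists_isProb_marginal_eq [Countable ι] [StandardBorelSpace N] {B : ℕ → Set ι}
    (hB : Monotone B) (hcover : ∀ i, ∃ n, i ∈ B n) {μ : ℕ → SignedMeasure (ι → N)}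
    (hprob : ∀ n, IsProb (μ n)) (hμ : ∀ n, marginal (B n) (μ (n + 1)) = marginal (B n) (μ n)) :
    ∃ ν : SignedMeasure (ι → N), IsProb ν ∧ ∀ n, marginal (B n) ν = marginal (B n) (μ n) := by
  choose P hP using hprob
  simp only [← hP, marginal_toSignedMeasure, Measure.toSignedMeasure_eq_toSignedMeasure_iff]
    at hμ ⊢
  obtain ⟨Q, hQ, hQP⟩ :=
    exists_measure_map_domRestrict_eq hB hcover (fun n => (P n : Measure (ι → N))) hμ
  refine ⟨Q.toSignedMeasure, ⟨⟨Q, hQ⟩, rfl⟩, fun n => ?_⟩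
  rw [marginal_toSignedMeasure, Measure.toSignedMeasure_eq_toSignedMeasure_iff, hQP]

end Marginals

section Words

variable {Λ : Type*} {μ ν : SignedMeasure (List Λ → ℕ)} {B : Set (List Λ)} {x : List Λ}

theorem shift_apply_append (x w : List Λ) (α : List Λ → ℕ) : shift x α (x ++ w) = α w := by
  simp [shift]

theorem shift_apply_of_not_prefix {x y : List Λ} (h : ¬ x <+: y) (α : List Λ → ℕ) :
    shift x α y = 0 := by
  simp [shift, h]

theorem act_apply (x : List Λ) (μ : SignedMeasure (List Λ → ℕ)) :
    WordAlgebra.act x μ = μ.map (shift x) := rfl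

theorem marginal_act_congr {C : Set (List Λ)} (hBC : ∀ w, x ++ w ∈ C → w ∈ B)
    (h : marginal B μ = marginal B ν) :
    marginal C (WordAlgebra.act x μ) = marginal C (WordAlgebra.act x ν) := by
  classical
  let shiftFrom (α : B → ℕ) (y : C) : ℕ :=
    if hy : ∃ w, x ++ w = y then α ⟨hy.choose, hBC _ (by rw [hy.choose_spec]; exact y.2)⟩ else 0
  have measurable_shiftFrom : Measurable shiftFrom := by
    refine measurable_pi_lambda _ fun y => ?_
    by_cases hy : ∃ w, x ++ w = y
    · simp only [shiftFrom, hy, dite_true]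
      fun_prop
    · simp only [shiftFrom, hy, dite_false]
      fun_prop
  have domRestrict_shift : C.domRestrict ∘ shift x = shiftFrom ∘ B.domRestrict := by
    ext α ⟨y, hyC⟩
    by_cases hy : ∃ w, x ++ w = y
    · have hw := hy.choose_spec
      simp only [Function.comp_apply, Set.domRestrict_apply, shiftFrom, hy, dite_true]
      rw [← shift_apply_append x hy.choose α, hw]
    · simp only [Function.comp_apply, Set.domRestrict_apply, shiftFrom, hy, dite_false]
      exact shift_apply_of_not_prefix hy α
  have marginal_act (ρ : SignedMeasure (List Λ → ℕ)) :
      marginal C (WordAlgebra.act x ρ) = (marginal B ρ).map shiftFrom := by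
    rw [act_apply, marginal_map _ _ (measurable_shift x), domRestrict_shift, marginal_apply,
      map_map _ (by fun_prop) measurable_shiftFrom]
  rw [marginal_act, marginal_act, h]

theorem IsProb.marginal_act_eq_one (hμ : IsProb μ) (hB : ∀ w ∈ B, ¬ x <+: w) :
    marginal B (WordAlgebra.act x μ) = 1 := by
  have domRestrict_shift : B.domRestrict ∘ shift x = fun _ => 0 := by
    ext α w
    exact shift_apply_of_not_prefix (hB w w.2) α
  rw [act_apply, marginal_map _ _ (measurable_shift x), domRestrict_shift, hμ.map_const]
  rfl

theorem marginal_act_eps [DecidableEq B] {w : List Λ} (hw : w ∈ B) :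
    marginal B (WordAlgebra.act w (WordAlgebra.eps Λ)) =
      VectorMeasure.dirac (Pi.single ⟨w, hw⟩ 1 : B → ℕ) 1 := by
  classical
  have domRestrict_shift : B.domRestrict (shift w (Pi.single [] 1)) = Pi.single ⟨w, hw⟩ 1 := by
    ext ⟨y, hy⟩
    by_cases hwy : w <+: y
    · obtain ⟨z, rfl⟩ := hwy
      rw [Set.domRestrict_apply, shift_apply_append]
      by_cases hz : z = [] <;> simp [hz]
    · have : y ≠ w := fun h => hwy (h ▸ List.prefix_rfl)
      rw [Set.domRestrict_apply, shift_apply_of_not_prefix hwy]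
      simp [this]
  rw [WordAlgebra.eps, instWordAlgebraSignedMeasure, marginal_apply]
  change ((VectorMeasure.dirac _ 1).map (shift w)).map _ = _
  rw [map_dirac (measurable_shift w), map_dirac (by fun_prop), domRestrict_shift]

end Words

section Semantics

variable {Λ S V : Type*} (M : Automaton Λ S)

section

variable [CommRing V] [Algebra ℝ V] [WordAlgebra Λ V]

/-- The operator `f ↦ f^‡ ∘ θ` on maps from the states to a word algebra. Its fixed points are the
semantics of the automaton with values in that algebra. -/
def unfolding (f : S → V) (s : S) : V := lift f (theta M s)

theorem unfolding_apply (f : S → V) (s : S) :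
    unfolding M f s = MvPolynomial.aeval
      (fun i => i.elim (WordAlgebra.eps Λ) fun z => WordAlgebra.act [z.1] (f z.2)) (M.trans s) := by
  rw [unfolding, lift, theta, MvPolynomial.aeval_rename]
  congr 2
  ext1 i
  rcases i with _ | z
  · simp [WordAlgebra.act_nil]
  · rfl

end

section

variable {f g : S → SignedMeasure (List Λ → ℕ)}

theorem isProb_unfolding (hf : ∀ s, IsProb (f s)) (s : S) : IsProb (unfolding M f s) := by
  rw [unfolding_apply]
  refine isProb_aeval (M.coeff_nonneg s) (M.sum_coeff s) fun i => ?_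
  rcases i with _ | ⟨a, t⟩
  · exact isProb_dirac _
  · exact (hf t).map (measurable_shift [a])

/-- The words of length less than `n`. These sets exhaust the words, and each unfolding of an
automaton determines its semantics on one more of them. -/
def ball (Λ : Type*) (n : ℕ) : Set (List Λ) := {w | w.length < n}

theorem ball_mono : Monotone (ball Λ) := fun _ _ h _ hw => lt_of_lt_of_le hw h

theorem mem_ball_succ_length (w : List Λ) : w ∈ ball Λ (w.length + 1) := Nat.lt_succ_self _

theorem marginal_ball_zero {μ : SignedMeasure (List Λ → ℕ)} (hμ : IsProb μ) :
    marginal (ball Λ 0) μ = 1 := by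
  have := hμ.marginal_act_eq_one (B := ball Λ 0) (x := []) fun w hw => absurd hw (Nat.not_lt_zero _)
  rwa [WordAlgebra.act_nil] at this

theorem ext_of_marginal_ball {μ ν : SignedMeasure (List Λ → ℕ)}
    (h : ∀ n, marginal (ball Λ n) μ = marginal (ball Λ n) ν) : μ = ν :=
  ext_of_marginal_finset fun I => by
    refine marginal_eq_of_subset (fun w hw => ?_) (h (I.sup List.length + 1))
    exact Nat.lt_succ_of_le (Finset.le_sup (f := List.length) hw)

theorem marginal_ball_unfolding_congr {n : ℕ}
    (h : ∀ s, marginal (ball Λ n) (f s) = marginal (ball Λ n) (g s)) (s : S) :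
    marginal (ball Λ (n + 1)) (unfolding M f s) = marginal (ball Λ (n + 1)) (unfolding M g s) := by
  rw [unfolding_apply, unfolding_apply, ← AlgHom.comp_apply, ← AlgHom.comp_apply]
  refine DFunLike.congr_fun (MvPolynomial.algHom_ext fun i => ?_) (M.trans s)
  simp only [AlgHom.comp_apply, MvPolynomial.aeval_X]
  rcases i with _ | ⟨a, t⟩
  · rfl
  · exact marginal_act_congr (fun w hw => Nat.lt_of_succ_lt_succ hw) (h t)

theorem eq_of_isFixedPt_unfolding (hf : ∀ s, IsProb (f s)) (hg : ∀ s, IsProb (g s))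
    (hf_fixed : Function.IsFixedPt (unfolding M) f)
    (hg_fixed : Function.IsFixedPt (unfolding M) g) : f = g := by
  have eq_on_ball (n : ℕ) : ∀ s, marginal (ball Λ n) (f s) = marginal (ball Λ n) (g s) := by
    induction n with
    | zero => exact fun s => by rw [marginal_ball_zero (hf s), marginal_ball_zero (hg s)]
    | succ n ih =>
      intro s
      rw [← hf_fixed, ← hg_fixed]
      exact marginal_ball_unfolding_congr M ih s
  exact funext fun s => ext_of_marginal_ball fun n => eq_on_ball n s

theorem exists_isFixedPt_unfolding [Countable Λ] :
    ∃ f : S → SignedMeasure (List Λ → ℕ),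
      (∀ s, IsProb (f s)) ∧ Function.IsFixedPt (unfolding M) f := by
  let approx (n : ℕ) : S → SignedMeasure (List Λ → ℕ) := (unfolding M)^[n] fun _ => 1
  have approx_succ (n : ℕ) : approx (n + 1) = unfolding M (approx n) :=
    Function.iterate_succ_apply' ..
  have isProb_approx (n : ℕ) : ∀ s, IsProb (approx n s) := by
    induction n with
    | zero => exact fun _ => isProb_one
    | succ n ih => exact approx_succ n ▸ isProb_unfolding M ih
  have approx_consistent (n : ℕ) :
      ∀ s, marginal (ball Λ n) (approx (n + 1) s) = marginal (ball Λ n) (approx n s) := by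
    induction n with
    | zero =>
      exact fun s => by
        rw [marginal_ball_zero (isProb_approx 1 s), marginal_ball_zero (isProb_approx 0 s)]
    | succ n ih =>
      rw [approx_succ (n + 1), approx_succ n]
      exact marginal_ball_unfolding_congr M (approx_succ n ▸ ih)
  choose f isProb_f hf using fun s => exists_isProb_marginal_eq (ball_mono (Λ := Λ))
    (fun w => ⟨_, mem_ball_succ_length w⟩) (fun n => isProb_approx n s)
    (fun n => approx_consistent n s)
  refine ⟨f, isProb_f, funext fun s => ext_of_marginal_ball fun n => ?_⟩
  refine marginal_eq_of_subset (ball_mono n.le_succ) ?_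
  rw [hf s (n + 1), approx_succ]
  exact marginal_ball_unfolding_congr M (fun t => hf t n) s

end

variable {M}

theorem isSemantics_iff_isFixedPt {sem : S → ProbabilityMeasure (List Λ → ℕ)} :
    IsSemantics M sem ↔
      Function.IsFixedPt (unfolding M)
        fun s => (sem s : Measure (List Λ → ℕ)).toSignedMeasure := by
  rw [Function.IsFixedPt, eq_comm, funext_iff]
  rfl

variable (M)

theorem existsUnique_isSemantics [Countable Λ] :
    ∃! sem : S → ProbabilityMeasure (List Λ → ℕ), IsSemantics M sem := by
  obtain ⟨f, isProb_f, hf⟩ := exists_isFixedPt_unfolding M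
  choose sem hsem using isProb_f
  obtain rfl : (fun s => (sem s : Measure (List Λ → ℕ)).toSignedMeasure) = f := funext hsem
  refine ⟨sem, isSemantics_iff_isFixedPt.2 hf, fun sem' hsem' => funext fun s => ?_⟩
  have := eq_of_isFixedPt_unfolding M (fun s => ⟨sem' s, rfl⟩) (fun s => ⟨sem s, rfl⟩)
    (isSemantics_iff_isFixedPt.1 hsem') hf
  exact ProbabilityMeasure.toMeasure_injective <|
    Measure.toSignedMeasure_eq_toSignedMeasure_iff.1 (congrFun this s)

end Semantics

section Trees

variable {Λ : Type*}

theorem boundary_nonempty [Nonempty Λ] (A : Finset (List Λ)) : (boundary A).Nonempty := by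
  obtain ⟨w, hw, hmin⟩ := (measure List.length).wf.has_min {w | w ∉ A} A.exists_notMem
  refine ⟨w, hw, fun y hy hyA => hy.eq_of_length_le (not_lt.1 (hmin y hyA))⟩

theorem exists_isTree_superset (I : Finset (List Λ)) : ∃ A, IsTree A ∧ I ⊆ A := by
  classical
  refine ⟨I.biUnion fun w => w.inits.toFinset, fun x hx y hy => ?_, fun w hw => ?_⟩
  · simp only [Finset.mem_biUnion, List.mem_toFinset, List.mem_inits] at hx ⊢
    obtain ⟨w, hw, hxw⟩ := hx
    exact ⟨w, hw, hy.trans hxw⟩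
  · simp only [Finset.mem_biUnion, List.mem_toFinset, List.mem_inits]
    exact ⟨w, hw, List.prefix_rfl⟩

end Trees

section TreeUnfolding

variable {Λ S V : Type*} [CommRing V] [Algebra ℝ V] [WordAlgebra Λ V] {M : Automaton Λ S}
  {f : S → V}

theorem act_X_inl (x w : List Λ) :
    WordAlgebra.act x (MvPolynomial.X (Sum.inl w) : Free Λ S) =
      MvPolynomial.X (Sum.inl (x ++ w)) :=
  MvPolynomial.rename_X _ _

theorem act_X_inr (x w : List Λ) (s : S) :
    WordAlgebra.act x (MvPolynomial.X (Sum.inr (w, s)) : Free Λ S) =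
      MvPolynomial.X (Sum.inr (x ++ w, s)) :=
  MvPolynomial.rename_X _ _

theorem lift_act (f : S → V) (x : List Λ) (p : Free Λ S) :
    lift f (WordAlgebra.act x p) = WordAlgebra.act x (lift f p) := by
  rw [← AlgHom.comp_apply, ← AlgHom.comp_apply]
  refine DFunLike.congr_fun (MvPolynomial.algHom_ext fun i => ?_) p
  rcases i with w | ⟨w, s⟩
  · simp [lift, act_X_inl, WordAlgebra.act_append]
  · simp [lift, act_X_inr, WordAlgebra.act_append]

theorem lift_thetaAt (hf : Function.IsFixedPt (unfolding M) f) (x : List Λ) (p : Free Λ S) :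
    lift f (thetaAt M x p) = lift f p := by
  rw [← AlgHom.comp_apply]
  refine DFunLike.congr_fun (MvPolynomial.algHom_ext fun i => ?_) p
  rw [AlgHom.comp_apply]
  rcases i with w | ⟨w, s⟩
  · rw [thetaAt_eps]
  · by_cases hx : x <+: w
    · rw [thetaAt_of_prefix M s hx, lift_act, ← unfolding, hf]
      simp [lift]
    · rw [thetaAt_of_not_prefix M s hx]

theorem lift_thetaTree (hf : Function.IsFixedPt (unfolding M) f) (A : Finset (List Λ))
    (p : MvPolynomial S ℝ) : lift f (thetaTree M A p) = lift f (incl Λ S p) := by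
  classical
  induction A using Finset.strongInduction with
  | H A ih =>
    rcases A.eq_empty_or_nonempty with rfl | hne
    · rw [thetaTree_empty]
    · obtain ⟨x, hx, -, hA⟩ := thetaTree_eq M hne
      rw [hA, AlgHom.comp_apply, lift_thetaAt hf, ih _ (Finset.erase_ssubset hx)]

end TreeUnfolding

section Decision

variable {Λ S : Type*}

/-- The indeterminates of `ℝ[A · ε, ∂A · S]`, the codomain of `θ_A`. -/
def treeIndeterminates (S : Type*) (A : Finset (List Λ)) : Set (List Λ ⊕ (List Λ × S)) :=
  {i | (∃ y ∈ A, i = Sum.inl y) ∨ ∃ y ∈ boundary A, ∃ t, i = Sum.inr (y, t)}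

/-- The substitution of `1` for all indeterminates `w · s`, which leaves a polynomial in the
indeterminates `w · ε`. -/
def forgetStates (Λ S : Type*) : Free Λ S →ₐ[ℝ] MvPolynomial (List Λ) ℝ :=
  MvPolynomial.aeval (Sum.elim MvPolynomial.X fun _ => 1)

theorem coeff_forgetStates (q : Free Λ S) (m : List Λ →₀ ℕ) :
    (forgetStates Λ S q).coeff m = MvPolynomial.aeval (fun _ => (1 : ℝ))
      ((MvPolynomial.sumAlgEquiv ℝ (List Λ) (List Λ × S) q).coeff m) := by
  have forgetStates_eq : forgetStates Λ S =
      (MvPolynomial.mapAlgHom (MvPolynomial.aeval fun _ => 1)).comp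
        (MvPolynomial.sumAlgEquiv ℝ (List Λ) (List Λ × S)).toAlgHom := by
    refine MvPolynomial.algHom_ext fun i => ?_
    rcases i with w | z <;> simp [forgetStates]
  simp [forgetStates_eq, MvPolynomial.coeff_map]

theorem forgetStates_mem_supported {A : Finset (List Λ)} {q : Free Λ S}
    (hq : q ∈ MvPolynomial.supported ℝ (treeIndeterminates S A)) :
    forgetStates Λ S q ∈ MvPolynomial.supported ℝ (A : Set (List Λ)) := by
  refine hom_mem ?_ hq
  rintro _ (⟨y, hy, rfl⟩ | ⟨y, -, t, rfl⟩)
  · simpa [forgetStates] using hy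
  · simp [forgetStates]

theorem coeff_forgetStates_eq_zero_of_not_subset {A : Finset (List Λ)} {q : Free Λ S}
    (hq : q ∈ MvPolynomial.supported ℝ (treeIndeterminates S A)) {m : List Λ →₀ ℕ}
    (hm : ¬ m.support ⊆ A) : (forgetStates Λ S q).coeff m = 0 := by
  contrapose! hm
  exact fun w hw => MvPolynomial.mem_supported.1 (forgetStates_mem_supported hq)
    ((MvPolynomial.mem_vars_iff_mem_support w).2 ⟨m, MvPolynomial.mem_support_iff.2 hm, hw⟩)

theorem bone_incl_dAt (M : Automaton Λ S) {A : Finset (List Λ)} (hA : IsTree A) (x : List Λ)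
    (m : List Λ →₀ ℕ) (p : MvPolynomial S ℝ) :
    bone Λ S (incl Λ S (dAt M A x m p)) = (forgetStates Λ S (thetaTree M A p)).coeff m := by
  have bone_incl (q : MvPolynomial S ℝ) : bone Λ S (incl Λ S q) =
      MvPolynomial.aeval (fun _ => (1 : ℝ)) (MvPolynomial.rename (fun s => (x, s)) q) := by
    rw [bone, lift, incl, MvPolynomial.aeval_rename, MvPolynomial.aeval_rename]
    rfl
  have aeval_partialEval (q : MvPolynomial (List Λ × S) ℝ) :
      MvPolynomial.aeval (fun _ => (1 : ℝ))
        (partialEval (boundary A \ {x}) (bone Λ S) (MvPolynomial.rename Sum.inr q)) =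
      MvPolynomial.aeval (fun _ => (1 : ℝ)) q := by
    rw [partialEval, MvPolynomial.aeval_rename, ← AlgHom.comp_apply]
    refine DFunLike.congr_fun (MvPolynomial.algHom_ext fun i => ?_) q
    simp only [AlgHom.comp_apply, MvPolynomial.aeval_X, Function.comp_apply, Sum.elim_inr]
    split_ifs <;> simp [bone, lift]
  rw [bone_incl, dAt_spec M A hA, coeff_forgetStates, dTreeOne, aeval_partialEval, dTree]

variable {A : Finset (List Λ)}

theorem marginal_lift (hA : IsTree A) {f : S → SignedMeasure (List Λ → ℕ)}
    (hf : ∀ s, IsProb (f s)) {q : Free Λ S}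
    (hq : q ∈ MvPolynomial.supported ℝ (treeIndeterminates S A)) :
    marginal (A : Set (List Λ)) (lift f q) =
      phiHom (A : Set (List Λ))
        (MvPolynomial.killCompl Subtype.val_injective (forgetStates Λ S q)) := by
  refine hom_congr (f := (marginal (A : Set (List Λ))).comp (lift f))
    (g := (FinSupp _).val.comp ((phiHom (A : Set (List Λ))).comp
      ((MvPolynomial.killCompl Subtype.val_injective).comp (forgetStates Λ S)))) ?_ hq
  rintro _ (⟨y, hy, rfl⟩ | ⟨y, hy, t, rfl⟩)
  · classical
    obtain ⟨i, rfl⟩ : ∃ i : (A : Set (List Λ)), y = i := ⟨⟨y, hy⟩, rfl⟩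
    simp only [AlgHom.comp_apply, lift, forgetStates, MvPolynomial.aeval_X, Sum.elim_inl]
    rw [marginal_act_eps i.2, ← MvPolynomial.rename_X, MvPolynomial.killCompl_rename_app, phiHom,
      MvPolynomial.aeval_X, Subalgebra.coe_val]
    congr!
  · have : ∀ w ∈ (A : Set (List Λ)), ¬ y <+: w := fun w hw h => hy.1 (hA w hw y h)
    simpa [lift, forgetStates] using (hf t).marginal_act_eq_one this

theorem marginal_lift_eq_zero_iff (hA : IsTree A) {f : S → SignedMeasure (List Λ → ℕ)}
    (hf : ∀ s, IsProb (f s)) {q : Free Λ S}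
    (hq : q ∈ MvPolynomial.supported ℝ (treeIndeterminates S A)) :
    marginal (A : Set (List Λ)) (lift f q) = 0 ↔ forgetStates Λ S q = 0 := by
  obtain ⟨r, hr⟩ : ∃ r, MvPolynomial.rename Subtype.val r =
      forgetStates Λ S q := by
    have := forgetStates_mem_supported hq
    rwa [MvPolynomial.supported_eq_range_rename] at this
  rw [marginal_lift hA hf hq, ← hr, MvPolynomial.killCompl_rename_app, ZeroMemClass.coe_eq_zero,
    map_eq_zero_iff _ (phiHom_bijective _).1,
    map_eq_zero_iff _ (MvPolynomial.rename_injective _ Subtype.val_injective)]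

theorem lift_incl_eq_zero_iff [Nonempty Λ] {M : Automaton Λ S}
    {f : S → SignedMeasure (List Λ → ℕ)} (hf : ∀ s, IsProb (f s))
    (hf_fixed : Function.IsFixedPt (unfolding M) f) (p : MvPolynomial S ℝ) :
    lift f (incl Λ S p) = 0 ↔
      ∀ A : Finset (List Λ), IsTree A → ∀ x ∈ boundary A, ∀ m : List Λ →₀ ℕ, m.support ⊆ A →
        incl Λ S (dAt M A x m p) ∈ RingHom.ker (bone Λ S) := by
  have marginal_lift_incl {A : Finset (List Λ)} (hA : IsTree A) :
      marginal (A : Set (List Λ)) (lift f (incl Λ S p)) = 0 ↔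
        forgetStates Λ S (thetaTree M A p) = 0 := by
    rw [← lift_thetaTree hf_fixed A, marginal_lift_eq_zero_iff hA hf (thetaTree_mem M A hA p)]
  constructor
  · intro h A hA x _ m _
    rw [RingHom.mem_ker, bone_incl_dAt M hA, (marginal_lift_incl hA).1 (by rw [h, map_zero]),
      MvPolynomial.coeff_zero]
  · intro h
    refine ext_of_marginal_finset fun I => ?_
    obtain ⟨A, hA, hIA⟩ := exists_isTree_superset I
    obtain ⟨x, hx⟩ := boundary_nonempty A
    refine marginal_eq_of_subset (Finset.coe_subset.2 hIA) ?_
    rw [map_zero, marginal_lift_incl hA]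
    ext m
    rw [MvPolynomial.coeff_zero]
    by_cases hm : m.support ⊆ A
    · rw [← bone_incl_dAt M hA x]
      exact h A hA x hx m hm
    · exact coeff_forgetStates_eq_zero_of_not_subset (thetaTree_mem M A hA p) hm

end Decision

end

end PKA

theorem mainTheorem2_general {Λ S : Type*} [Countable Λ] [Nonempty Λ] [Finite S]
    (M : PKA.Automaton Λ S) :
    (∃! sem : S → MeasureTheory.ProbabilityMeasure (List Λ → ℕ), PKA.IsSemantics M sem) ∧
    ∀ sem : S → MeasureTheory.ProbabilityMeasure (List Λ → ℕ), PKA.IsSemantics M sem →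
      ∀ μ ν : PKA.FinSupp S,
        (PKA.semExt sem μ = PKA.semExt sem ν ↔
          ∀ A : Finset (List Λ), PKA.IsTree A → ∀ x ∈ PKA.boundary A,
            ∀ m : List Λ →₀ ℕ, m.support ⊆ A →
              PKA.incl Λ S (PKA.dAt M A x m ((PKA.phi S).symm (μ - ν))) ∈
                RingHom.ker (PKA.bone Λ S)) := by
  refine ⟨PKA.existsUnique_isSemantics M, fun sem hsem μ ν => ?_⟩
  rw [← PKA.lift_incl_eq_zero_iff (fun s => ⟨sem s, rfl⟩) (PKA.isSemantics_iff_isFixedPt.1 hsem),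
    map_sub, map_sub, map_sub, sub_eq_zero]
  rfl

theorem mainTheorem2 {Λ S : Type*} [Finite Λ] [Nonempty Λ] [Finite S] (M : PKA.Automaton Λ S) :
    (∃! sem : S → MeasureTheory.ProbabilityMeasure (List Λ → ℕ), PKA.IsSemantics M sem) ∧
    ∀ sem : S → MeasureTheory.ProbabilityMeasure (List Λ → ℕ), PKA.IsSemantics M sem →
      ∀ μ ν : PKA.FinSupp S,
        (PKA.semExt sem μ = PKA.semExt sem ν ↔
          ∀ A : Finset (List Λ), PKA.IsTree A → ∀ x ∈ PKA.boundary A,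
            ∀ m : List Λ →₀ ℕ, m.support ⊆ A →
              PKA.incl Λ S (PKA.dAt M A x m ((PKA.phi S).symm (μ - ν))) ∈
                RingHom.ker (PKA.bone Λ S)) :=
  mainTheorem2_general M
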